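/- Let $M$ be a connected smooth manifold (finite-dimensional, Hausdorff, second countable, without boundary) with $H^1(M)=0$ (de Rham cohomology), and let $\omega$ be a 2-plectic form on $M$, i.e. a closed 3-form such that $T_xM\ni v\mapsto \iota_v\omega\in\wedge^2T_x^*M$ is injective for every $x\in M$. A 1-form $\alpha$ is Hamiltonian with Hamiltonian vector field $v_\alpha$ if $d\alpha=-\iota_{v_\alpha}\omega$; write $\Omega^1_{\rm Ham}(M)$ for the space of Hamiltonian 1-forms. Let $L_\infty(M,\omega)$ be the Lie 2-algebra with $\Omega^1_{\rm Ham}(M)$ in degree $0$, $C^\infty(M)$ in degree $-1$, unary bracket $d:C^\infty(M)\to\Omega^1_{\rm Ham}(M)$, binary bracket $[\alpha,\beta]'=\iota_{v_\beta}\iota_{v_\alpha}\omega$ and trinary bracket $[\alpha,\beta,\gamma]'=-\iota_{v_\gamma}\iota_{v_\beta}\iota_{v_\alpha}\omega$ on degree-$0$ elements, all other brackets being zero. Let $\mathfrak g$ be a finite-dimensional real abelian Lie algebra, and let $\mathfrak g\to\mathfrak X(M)$, $x\mapsto v_x$, be a Lie algebra morphism such that every $v_x$ is a Hamiltonian vector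 field. Let $\mathfrak h[1]\oplus\mathfrak g$ be a minimal Lie 2-algebra extending $\mathfrak g$, i.e. $\mathfrak h$ is a finite-dimensional representation of $\mathfrak g$ (the binary bracket, $[x,h]=x\cdot h=-[h,x]$), the unary bracket is zero, and the trinary bracket is a Chevalley–Eilenberg 3-cocycle $c:\wedge^3\mathfrak g\to\mathfrak h$ with values in $\mathfrak h$. An $\mathfrak h[1]\oplus\mathfrak g$ moment map is an $L_\infty$-morphism $(f_1,f_2)$ from $\mathfrak h[1]\oplus\mathfrak g$ to $L_\infty(M,\omega)$ such that $d(f_1(x))=-\iota_{v_x}\omega$ for all $x\in\mathfrak g$. Explicitly, it consists of linear maps $f_1:\mathfrak g\to\Omega^1_{\rm Ham}(M)$, $f_1:\mathfrak h\to C^\infty(M)$, $f_2:\wedge^2\mathfrak g\to C^\infty(M)$ with, for all $x,y,z\in\mathfrak g$ and $h\in\mathfrak h$, $d(f_1(x))=-\iota_{v_x}\omega$, $d(f_1(h))=0$, $f_1([h,x])=0$, $$d f_2(x,y)=f_1([x,y])-[f_1(x),f_1(y)]',$$ $$f_1(c(x,y,z))-[f_1(x),f_1(y),f_1(z)]'=f_2(x,[y,z])-f_2(y,[x,z])+f_2(z,[x,y]).$$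 Fix any point $p\in M$, let $\omega_{3p}:\wedge^3\mathfrak g\to\mathbb R$ be the linear map with $\omega_{3p}(x\wedge y\wedge z)=\omega(v_x,v_y,v_z)|_p$, and put $U=\{u\in\wedge^3\mathfrak g: c(u)\in[\mathfrak g,\mathfrak h]\}$, where $[\mathfrak g,\mathfrak h]\subseteq\mathfrak h$ is the linear span of all $[x,h]$. Then an $\mathfrak h[1]\oplus\mathfrak g$ moment map exists if and only if $\omega_{3p}|_U=0$. -/

import Mathlib

open scoped Manifold ContDiff

noncomputable section

namespace Lie2Moment

/-! ### Differential forms on a manifold -/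

/-- `ℝⁿ`, the model space of an `n`-dimensional manifold. -/
abbrev Model (n : ℕ) : Type := EuclideanSpace ℝ (Fin n)

section Forms

variable (n : ℕ) (M : Type*) [TopologicalSpace M] [ChartedSpace (Model n) M]

/-- The algebra `C^∞(M)` of smooth real-valued functions on `M`. -/
abbrev SmoothFun := C^∞⟮𝓡 n, M; 𝓘(ℝ, ℝ), ℝ⟯

/-- Families of alternating `k`-forms on the tangent spaces of `M`, with no regularity in the
base point. -/
def RawForm (k : ℕ) : Type _ :=
  ∀ x : M, TangentSpace (𝓡 n) x [⋀^Fin k]→L[ℝ] ℝ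

instance (k : ℕ) : AddCommGroup (RawForm n M k) :=
  inferInstanceAs (AddCommGroup (∀ x : M, TangentSpace (𝓡 n) x [⋀^Fin k]→L[ℝ] ℝ))

instance (k : ℕ) : Module ℝ (RawForm n M k) :=
  inferInstanceAs (Module ℝ (∀ x : M, TangentSpace (𝓡 n) x [⋀^Fin k]→L[ℝ] ℝ))

variable {n M}

/-- The derivative at `x` of the chart around `x`. -/
def chartDeriv (x : M) : TangentSpace (𝓡 n) x →L[ℝ] Model n :=
  mfderiv (𝓡 n) 𝓘(ℝ, Model n) (extChartAt (𝓡 n) x) x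

/-- The derivative at `y` of the inverse of the chart around `x₀`. -/
def chartSymmDeriv (x₀ : M) (y : Model n) :
    Model n →L[ℝ] TangentSpace (𝓡 n) ((extChartAt (𝓡 n) x₀).symm y) :=
  mfderiv 𝓘(ℝ, Model n) (𝓡 n) (extChartAt (𝓡 n) x₀).symm y

/-- The expression of a `k`-form in the chart around `x₀`: its pullback along the inverse
chart. It is meaningful on the target of the chart. -/
def chartRep {k : ℕ} (α : RawForm n M k) (x₀ : M) (y : Model n) :
    Model n [⋀^Fin k]→L[ℝ] ℝ :=
  (α ((extChartAt (𝓡 n) x₀).symm y)).compContinuousLinearMap (chartSymmDeriv x₀ y)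

/-- A form is smooth when all its expressions in charts are smooth. -/
def IsSmoothForm {k : ℕ} (α : RawForm n M k) : Prop :=
  ∀ x₀ : M, ContDiffOn ℝ ∞ (chartRep α x₀) (extChartAt (𝓡 n) x₀).target

theorem chartRep_add {k : ℕ} (α β : RawForm n M k) (x₀ : M) :
    chartRep (α + β) x₀ = chartRep α x₀ + chartRep β x₀ := rfl

theorem chartRep_smul {k : ℕ} (r : ℝ) (α : RawForm n M k) (x₀ : M) :
    chartRep (r • α) x₀ = r • chartRep α x₀ := rfl

theorem chartRep_zero {k : ℕ} (x₀ : M) :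
    chartRep (0 : RawForm n M k) x₀ = 0 := rfl

variable (n M) in
/-- The space `Ωᵏ(M)` of smooth differential `k`-forms. -/
def Form (k : ℕ) : Submodule ℝ (RawForm n M k) where
  carrier := {α | IsSmoothForm α}
  zero_mem' := fun x₀ => by
    rw [chartRep_zero]; exact contDiffOn_const
  add_mem' := fun {α β} hα hβ x₀ => by
    rw [chartRep_add]; exact (hα x₀).add (hβ x₀)
  smul_mem' := fun r α hα x₀ => by
    rw [chartRep_smul]; exact contDiffOn_const.smul (hα x₀)

/-- The exterior derivative at `x`, computed in the chart around `x`. -/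
def extDerRaw {k : ℕ} (α : RawForm n M k) : RawForm n M (k + 1) := fun x =>
  (extDeriv (chartRep α x) (extChartAt (𝓡 n) x x)).compContinuousLinearMap (chartDeriv x)

theorem differentiableAt_chartRep {k : ℕ} (α : Form n M k) (x : M) :
    DifferentiableAt ℝ (chartRep α.1 x) (extChartAt (𝓡 n) x x) :=
  ((α.2 x).contDiffAt (extChartAt_target_mem_nhds x)).differentiableAt (by simp)

/-- The de Rham differential on smooth `k`-forms. -/
def extDer (k : ℕ) : Form n M k →ₗ[ℝ] RawForm n M (k + 1) where
  toFun α := extDerRaw α.1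
  map_add' α β := by
    funext x
    simp only [extDerRaw, Submodule.coe_add, chartRep_add]
    rw [extDeriv_add (differentiableAt_chartRep α x) (differentiableAt_chartRep β x)]
    rfl
  map_smul' r α := by
    funext x
    simp only [extDerRaw, Submodule.coe_smul, chartRep_smul]
    rw [extDeriv_smul r]
    rfl

/-- The de Rham differential on functions. -/
def extDerFun : SmoothFun n M →ₗ[ℝ] RawForm n M 1 where
  toFun f := fun x =>
    ContinuousAlternatingMap.ofSubsingleton ℝ (TangentSpace (𝓡 n) x) ℝ (0 : Fin 1)
      (mfderiv (𝓡 n) 𝓘(ℝ, ℝ) f x)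
  map_add' f g := by
    funext x
    have hf : MDifferentiableAt (𝓡 n) 𝓘(ℝ, ℝ) f x := f.contMDiff.mdifferentiableAt (by simp)
    have hg : MDifferentiableAt (𝓡 n) 𝓘(ℝ, ℝ) g x := g.contMDiff.mdifferentiableAt (by simp)
    simp only [ContMDiffMap.coe_add]
    rw [mfderiv_add hf hg]
    rfl
  map_smul' r f := by
    funext x
    have hf : MDifferentiableAt (𝓡 n) 𝓘(ℝ, ℝ) f x := f.contMDiff.mdifferentiableAt (by simp)
    simp only [ContMDiffMap.coe_smul]
    rw [const_smul_mfderiv hf r]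
    rfl

variable (n M) in
/-- The space of closed 1-forms. -/
abbrev ClosedOneForm : Submodule ℝ (Form n M 1) := LinearMap.ker (extDer 1)

variable (n M) in
/-- The space of exact 1-forms, i.e. of differentials of smooth functions. -/
abbrev ExactOneForm : Submodule ℝ (Form n M 1) :=
  (LinearMap.range (extDerFun (n := n) (M := M))).submoduleOf (Form n M 1)

variable (n M) in
/-- The first de Rham cohomology `H¹(M)`: closed 1-forms modulo exact ones. -/
abbrev DeRhamH1 : Type _ :=
  ClosedOneForm n M ⧸ (ExactOneForm n M).submoduleOf (ClosedOneForm n M)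

variable [IsManifold (𝓡 n) ∞ M]

variable (n M) in
/-- The space `𝔛(M)` of smooth vector fields. -/
abbrev VField : Type _ :=
  Cₛ^∞⟮𝓡 n; Model n, (TangentSpace (𝓡 n) : M → Type _)⟯

/-- The contraction `ι_v α = α(v, ⋯)`. -/
def contract {k : ℕ} (v : VField n M) (α : RawForm n M (k + 1)) : RawForm n M k := fun x =>
  ContinuousAlternatingMap.curryLeft (E := Model n) (α x) (v x)

theorem contract_apply {k : ℕ} (v : VField n M) (α : RawForm n M (k + 1)) (x : M)
    (w : Fin k → TangentSpace (𝓡 n) x) :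
    contract v α x w = α x (Matrix.vecCons (v x) w) := rfl

theorem contract_add_left {k : ℕ} (v w : VField n M) (α : RawForm n M (k + 1)) :
    contract (v + w) α = contract v α + contract w α := by
  funext x
  exact map_add (ContinuousAlternatingMap.curryLeft (E := Model n) (α x)) (v x) (w x)

theorem contract_smul_left {k : ℕ} (r : ℝ) (v : VField n M) (α : RawForm n M (k + 1)) :
    contract (r • v) α = r • contract v α := by
  funext x
  exact map_smul (ContinuousAlternatingMap.curryLeft (E := Model n) (α x)) r (v x)

theorem contract_zero_left {k : ℕ} (α : RawForm n M (k + 1)) :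
    contract (0 : VField n M) α = 0 := by
  funext x
  exact map_zero (ContinuousAlternatingMap.curryLeft (E := Model n) (α x))

/-! ### 2-plectic forms and their observables -/

/-- `ω₀` is 2-plectic: closed, and `v ↦ ω₀(v, ·, ·)` is injective on every tangent space. -/
structure IsTwoPlectic (ω₀ : Form n M 3) : Prop where
  closed : extDer 3 ω₀ = 0
  nondegenerate : ∀ (x : M) (v : TangentSpace (𝓡 n) x),
    (∀ a b : TangentSpace (𝓡 n) x, ω₀.1 x ![v, a, b] = 0) → v = 0

/-- `v` is a Hamiltonian vector field of the 1-form `α`: `dα = -ι_v ω₀`. -/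
def IsHamiltonianPair (ω₀ : Form n M 3) (α : Form n M 1) (v : VField n M) : Prop :=
  extDer 1 α = -contract v ω₀.1

/-- The space `Ω¹_Ham(M)` of Hamiltonian 1-forms. -/
def HamForm (ω₀ : Form n M 3) : Submodule ℝ (Form n M 1) where
  carrier := {α | ∃ v : VField n M, IsHamiltonianPair ω₀ α v}
  zero_mem' := ⟨0, by rw [IsHamiltonianPair, map_zero, contract_zero_left, neg_zero]⟩
  add_mem' := by
    rintro α β ⟨v, hv⟩ ⟨w, hw⟩
    refine ⟨v + w, ?_⟩
    rw [IsHamiltonianPair] at hv hw ⊢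
    rw [map_add, hv, hw, contract_add_left, neg_add]
  smul_mem' := by
    rintro r α ⟨v, hv⟩
    refine ⟨r • v, ?_⟩
    rw [IsHamiltonianPair] at hv ⊢
    rw [map_smul, hv, contract_smul_left, smul_neg]

/-- A Hamiltonian vector field of a Hamiltonian 1-form; it is unique when `ω₀` is
nondegenerate. -/
def hamField {ω₀ : Form n M 3} (α : HamForm ω₀) : VField n M := α.2.choose

/-- The binary bracket of `L_∞(M, ω₀)` in degree zero:
`[α, β]' = ι_{v_β} ι_{v_α} ω₀ = ω₀(v_α, v_β, ·)`. -/
def obsBracket₂ {ω₀ : Form n M 3} (α β : HamForm ω₀) : RawForm n M 1 :=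
  contract (hamField β) (contract (hamField α) ω₀.1)

/-- The trinary bracket of `L_∞(M, ω₀)` in degree zero:
`[α, β, γ]' = -ι_{v_γ} ι_{v_β} ι_{v_α} ω₀ = -ω₀(v_α, v_β, v_γ)`, a function on `M`. -/
def obsBracket₃ {ω₀ : Form n M 3} (α β γ : HamForm ω₀) (x : M) : ℝ :=
  -ω₀.1 x ![hamField α x, hamField β x, hamField γ x]

end Forms

/-! ### Minimal Lie 2-algebras -/

section LieTwo

variable {𝔤 𝔥 : Type*} [LieRing 𝔤] [LieAlgebra ℝ 𝔤]
  [AddCommGroup 𝔥] [Module ℝ 𝔥] [LieRingModule 𝔤 𝔥] [LieModule ℝ 𝔤 𝔥]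

/-- `c : ⋀³𝔤 → 𝔥` is a Chevalley–Eilenberg 3-cocycle with values in the representation `𝔥`. -/
def IsThreeCocycle (c : 𝔤 [⋀^Fin 3]→ₗ[ℝ] 𝔥) : Prop :=
  ∀ x y z u : 𝔤,
    ⁅x, c ![y, z, u]⁆ - ⁅y, c ![x, z, u]⁆ + ⁅z, c ![x, y, u]⁆ - ⁅u, c ![x, y, z]⁆
      - c ![⁅x, y⁆, z, u] + c ![⁅x, z⁆, y, u] - c ![⁅x, u⁆, y, z]
      - c ![⁅y, z⁆, x, u] + c ![⁅y, u⁆, x, z] - c ![⁅z, u⁆, x, y] = 0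

variable (𝔤 𝔥) in
/-- A minimal Lie 2-algebra structure on `𝔥[1] ⊕ 𝔤` whose binary bracket is given by the Lie
bracket of `𝔤` and the representation of `𝔤` on `𝔥`: the unary bracket vanishes, and the
trinary bracket is a 3-cocycle. -/
structure MinimalLieTwo where
  /-- the trinary bracket `⋀³𝔤 → 𝔥` -/
  c : 𝔤 [⋀^Fin 3]→ₗ[ℝ] 𝔥
  cocycle : IsThreeCocycle c

/-! ### Moment maps -/

variable {n : ℕ} {M : Type*} [TopologicalSpace M] [ChartedSpace (Model n) M]
  [IsManifold (𝓡 n) ∞ M]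

/-- `L_∞`-morphisms `(f₁, f₂)` from the minimal Lie 2-algebra `𝔥[1] ⊕ 𝔤` to `L_∞(M, ω₀)`. -/
structure LInfMorphism (L : MinimalLieTwo 𝔤 𝔥) (ω₀ : Form n M 3) where
  /-- `f₁` in degree `0` -/
  f₁ : 𝔤 →ₗ[ℝ] HamForm ω₀
  /-- `f₁` in degree `-1` -/
  f₁' : 𝔥 →ₗ[ℝ] SmoothFun n M
  /-- `f₂ : ⋀²𝔤 → C^∞(M)` -/
  f₂ : 𝔤 [⋀^Fin 2]→ₗ[ℝ] SmoothFun n M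
  /-- `d ∘ f₁ = f₁ ∘ δ` with `δ = 0` -/
  map_unary : ∀ h : 𝔥, extDerFun (f₁' h) = 0
  /-- `d f₂(x, y) = f₁[x, y] - [f₁ x, f₁ y]'` -/
  map_binary : ∀ x y : 𝔤,
    extDerFun (f₂ ![x, y]) = (f₁ ⁅x, y⁆ : Form n M 1).1 - obsBracket₂ (f₁ x) (f₁ y)
  /-- `f₂(δ h, x) = f₁[h, x]` with `δ = 0` and `[h, x] = -[x, h]` -/
  map_action : ∀ (x : 𝔤) (h : 𝔥), f₁' (-⁅x, h⁆) = 0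
  /-- `f₁[x, y, z] - [f₁ x, f₁ y, f₁ z]' = f₂(x, [y, z]) - f₂(y, [x, z]) + f₂(z, [x, y])` -/
  map_trinary : ∀ (x y z : 𝔤) (p : M),
    f₁' (L.c ![x, y, z]) p - obsBracket₃ (f₁ x) (f₁ y) (f₁ z) p =
      f₂ ![x, ⁅y, z⁆] p - f₂ ![y, ⁅x, z⁆] p + f₂ ![z, ⁅x, y⁆] p

variable (𝔤) in
/-- An infinitesimal action of `𝔤` on `(M, ω₀)` by Hamiltonian vector fields: a Lie algebra
morphism `𝔤 → 𝔛(M)`, `x ↦ v_x`, with Hamiltonian values. -/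
structure HamiltonianAction (ω₀ : Form n M 3) where
  /-- the linear map `x ↦ v_x` -/
  v : 𝔤 →ₗ[ℝ] VField n M
  map_lie : ∀ (x y : 𝔤) (p : M), v ⁅x, y⁆ p = VectorField.mlieBracket (𝓡 n) (v x) (v y) p
  hamiltonian : ∀ x : 𝔤, ∃ α : Form n M 1, IsHamiltonianPair ω₀ α (v x)

/-- A homotopy moment map for `𝔥[1] ⊕ 𝔤`: an `L_∞`-morphism with `d(f₁ x) = -ι_{v_x} ω₀`. -/
def IsMomentMap {L : MinimalLieTwo 𝔤 𝔥} {ω₀ : Form n M 3} (A : HamiltonianAction 𝔤 ω₀)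
    (f : LInfMorphism L ω₀) : Prop :=
  ∀ x : 𝔤, IsHamiltonianPair ω₀ (f.f₁ x) (A.v x)

/-- Evaluation of vector fields at a point. -/
def evalField (p : M) : VField n M →ₗ[ℝ] TangentSpace (𝓡 n) p where
  toFun v := v p
  map_add' _ _ := rfl
  map_smul' _ _ := rfl

/-- The trilinear alternating form `ω_{3p}(x, y, z) = ω₀(v_x, v_y, v_z)|_p` on `𝔤`. -/
def omega3p {ω₀ : Form n M 3} (A : HamiltonianAction 𝔤 ω₀) (p : M) : 𝔤 [⋀^Fin 3]→ₗ[ℝ] ℝ :=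
  (ω₀.1 p).toAlternatingMap.compLinearMap (evalField p ∘ₗ A.v)

/-- `U = {u ∈ ⋀³𝔤 : c(u) ∈ [𝔤, 𝔥]}`. -/
def subspaceU (L : MinimalLieTwo 𝔤 𝔥) : Submodule ℝ (⋀[ℝ]^3 𝔤) :=
  (⁅(⊤ : LieIdeal ℝ 𝔤), (⊤ : LieSubmodule ℝ 𝔤 𝔥)⁆ : LieSubmodule ℝ 𝔤 𝔥).toSubmodule.comap
    (exteriorPower.alternatingMapLinearEquiv L.c)

end LieTwo

end Lie2Moment

end

open Lie2Moment

/-!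
For abelian `𝔤` all terms of the moment map equations that contain a bracket of `𝔤` drop out. What
is left is: 1-forms `f₁ x` with `d (f₁ x) = -ι_{v_x} ω₀`, locally constant functions `f₁ h`
vanishing for `h ∈ [𝔤, 𝔥]`, functions `f₂(x, y)` with `d f₂(x, y) = -ι_{v_y} ι_{v_x} ω₀`, and the
single coupling condition `f₁ (c(x, y, z)) = -ω₀(v_x, v_y, v_z)`.

The vector fields `v_x` commute and preserve `ω₀`, so Cartan calculus shows that every
`ι_{v_y} ι_{v_x} ω₀` is closed (`extDer_contract_contract_eq_zero`) and every `ω₀(v_x, v_y, v_z)` is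
locally constant (`isLocallyConstant_threeForm_apply`). Since `H¹(M) = 0`, the forms `f₁ x` and the
functions `f₂(x, y)` always exist, and can be chosen linearly because `d` has a linear section over
its range. Since `M` is connected, the coupling condition only has to be considered at the point
`p`, where it says that `-ω_{3p}` is the composite of `c : ⋀³𝔤 → 𝔥` with a functional that kills
`[𝔤, 𝔥]`. Such a functional exists exactly when `ω_{3p}` vanishes on
`U = ker (⋀³𝔤 → 𝔥 ⧸ [𝔤, 𝔥])`.

The exterior derivative and the bracket of vector fields are defined at each point through the
chart around that point. Closedness of `dα` needs the values of `dα` near a point in one chart;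
`chartRep_extDerRaw`, the independence of `d` of the chart, provides them. With this, the Cartan
calculus reduces to pointwise computations for 3-forms on a normed space
(`extDeriv_curryLeft_curryLeft_eq_zero`, `fderiv_threeForm_eq_zero`).
-/

namespace Lie2Moment

open Set Filter Topology VectorField

/-! ### Cartan calculus for 3-forms on a normed space -/

section NormedSpace

variable {E : Type*} [NormedAddCommGroup E] [NormedSpace ℝ E]

theorem contDiffWithinAt_curryLeft_apply {k : ℕ} {m : ℕ∞ω} {η : E → E [⋀^Fin (k + 1)]→L[ℝ] ℝ}
    {X : E → E} {s : Set E} {y : E} (hη : ContDiffWithinAt ℝ m η s y)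
    (hX : ContDiffWithinAt ℝ m X s y) :
    ContDiffWithinAt ℝ m (fun z => (η z).curryLeft (X z)) s y := by
  let C : (E [⋀^Fin (k + 1)]→L[ℝ] ℝ) →L[ℝ] E →L[ℝ] E [⋀^Fin k]→L[ℝ] ℝ :=
    ContinuousAlternatingMap.curryLeftLI.toContinuousLinearMap
  exact (C.contDiff.comp_contDiffWithinAt hη).clm_apply hX

/-- Stated for variable normed spaces, so that it can be applied to spaces of alternating maps with
the types given explicitly: there unification does not find the norms by itself. -/
theorem differentiableAt_clm_comp {F G : Type*} [NormedAddCommGroup F] [NormedSpace ℝ F]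
    [NormedAddCommGroup G] [NormedSpace ℝ G] (C : F →L[ℝ] G) {η : E → F} {y : E}
    (hη : DifferentiableAt ℝ η y) : DifferentiableAt ℝ (fun z => C (η z)) y :=
  C.differentiableAt.comp y hη

theorem differentiableAt_curryLeft_apply {k : ℕ} {η : E → E [⋀^Fin (k + 1)]→L[ℝ] ℝ}
    {X : E → E} {y : E} (hη : DifferentiableAt ℝ η y) (hX : DifferentiableAt ℝ X y) :
    DifferentiableAt ℝ (fun z => (η z).curryLeft (X z)) y := by
  let C : (E [⋀^Fin (k + 1)]→L[ℝ] ℝ) →L[ℝ] E →L[ℝ] E [⋀^Fin k]→L[ℝ] ℝ :=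
    ContinuousAlternatingMap.curryLeftLI.toContinuousLinearMap
  have h : DifferentiableAt ℝ (fun z => C (η z)) y :=
    differentiableAt_clm_comp (F := E [⋀^Fin (k + 1)]→L[ℝ] ℝ)
      (G := E →L[ℝ] E [⋀^Fin k]→L[ℝ] ℝ) C hη
  exact h.clm_apply hX

theorem differentiableAt_threeForm_apply {η : E → E [⋀^Fin 3]→L[ℝ] ℝ} {X Y Z : E → E} {y : E}
    (hη : DifferentiableAt ℝ η y) (hX : DifferentiableAt ℝ X y) (hY : DifferentiableAt ℝ Y y)
    (hZ : DifferentiableAt ℝ Z y) : DifferentiableAt ℝ (fun z => η z ![X z, Y z, Z z]) y :=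
  (differentiableAt_curryLeft_apply (differentiableAt_curryLeft_apply
    (differentiableAt_curryLeft_apply hη hX) hY) hZ).continuousAlternatingMap_apply_const ![]

theorem threeForm_swap_fst (η : E [⋀^Fin 3]→L[ℝ] ℝ) (a b c : E) :
    η ![b, a, c] = -η ![a, b, c] := by
  have h := η.toAlternatingMap.map_swap ![a, b, c] (i := 0) (j := 1) (by decide)
  have e : ![a, b, c] ∘ Equiv.swap (0 : Fin 3) 1 = ![b, a, c] := by
    funext i; fin_cases i <;> rfl
  rwa [e] at h

theorem threeForm_swap_snd (η : E [⋀^Fin 3]→L[ℝ] ℝ) (a b c : E) :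
    η ![a, c, b] = -η ![a, b, c] := by
  have h := η.toAlternatingMap.map_swap ![a, b, c] (i := 1) (j := 2) (by decide)
  have e : ![a, b, c] ∘ Equiv.swap (1 : Fin 3) 2 = ![a, c, b] := by
    funext i; fin_cases i <;> rfl
  rwa [e] at h

theorem fderiv_threeForm_apply {η : E → E [⋀^Fin 3]→L[ℝ] ℝ} {X Y Z : E → E} {y : E}
    (hη : DifferentiableAt ℝ η y) (hX : DifferentiableAt ℝ X y) (hY : DifferentiableAt ℝ Y y)
    (hZ : DifferentiableAt ℝ Z y) (a : E) :
    fderiv ℝ (fun z => η z ![X z, Y z, Z z]) y a =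
      fderiv ℝ η y a ![X y, Y y, Z y] + η y ![fderiv ℝ X y a, Y y, Z y] +
      η y ![X y, fderiv ℝ Y y a, Z y] + η y ![X y, Y y, fderiv ℝ Z y a] := by
  have hV : ∀ i, HasFDerivAt ((![X, Y, Z] : Fin 3 → E → E) i)
      ((![fderiv ℝ X y, fderiv ℝ Y y, fderiv ℝ Z y] : Fin 3 → E →L[ℝ] E) i) y := by
    intro i
    fin_cases i
    exacts [hX.hasFDerivAt, hY.hasFDerivAt, hZ.hasFDerivAt]
  have h := hη.hasFDerivAt.continuousAlternatingMap_apply hV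
  have hvec : ∀ z, (fun i => (![X, Y, Z] : Fin 3 → E → E) i z) = ![X z, Y z, Z z] := by
    intro z
    funext i
    fin_cases i <;> rfl
  simp only [hvec] at h
  rw [h.fderiv]
  have h0 : Function.update ![X y, Y y, Z y] 0 (fderiv ℝ X y a) =
      ![fderiv ℝ X y a, Y y, Z y] := by
    funext i; fin_cases i <;> rfl
  have h1 : Function.update ![X y, Y y, Z y] 1 (fderiv ℝ Y y a) =
      ![X y, fderiv ℝ Y y a, Z y] := by
    funext i; fin_cases i <;> rfl
  have h2 : Function.update ![X y, Y y, Z y] 2 (fderiv ℝ Z y a) =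
      ![X y, Y y, fderiv ℝ Z y a] := by
    funext i; fin_cases i <;> rfl
  simp [Fin.sum_univ_three, h0, h1, h2, add_assoc]

theorem extDeriv_threeForm_apply (η : E → E [⋀^Fin 3]→L[ℝ] ℝ) (y a b c e : E) :
    extDeriv η y ![a, b, c, e] =
      fderiv ℝ η y a ![b, c, e] - fderiv ℝ η y b ![a, c, e] + fderiv ℝ η y c ![a, b, e] -
        fderiv ℝ η y e ![a, b, c] := by
  rw [extDeriv, ContinuousAlternatingMap.alternatizeUncurryFin_apply, Fin.sum_univ_four]
  have h0 : (0 : Fin 4).removeNth ![a, b, c, e] = ![b, c, e] := by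
    funext i; fin_cases i <;> rfl
  have h1 : (1 : Fin 4).removeNth ![a, b, c, e] = ![a, c, e] := by
    funext i; fin_cases i <;> rfl
  have h2 : (2 : Fin 4).removeNth ![a, b, c, e] = ![a, b, e] := by
    funext i; fin_cases i <;> rfl
  have h3 : (3 : Fin 4).removeNth ![a, b, c, e] = ![a, b, c] := by
    funext i; fin_cases i <;> rfl
  rw [h0, h1, h2, h3]
  simp
  ring

theorem extDeriv_twoForm_apply {θ : E → E [⋀^Fin 2]→L[ℝ] ℝ} {y : E}
    (hθ : DifferentiableAt ℝ θ y) (a b c : E) :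
    extDeriv θ y ![a, b, c] =
      fderiv ℝ (fun z => θ z ![b, c]) y a - fderiv ℝ (fun z => θ z ![a, c]) y b +
        fderiv ℝ (fun z => θ z ![a, b]) y c := by
  rw [extDeriv_apply hθ, Fin.sum_univ_three]
  have h0 : (0 : Fin 3).removeNth ![a, b, c] = ![b, c] := by
    funext i; fin_cases i <;> rfl
  have h1 : (1 : Fin 3).removeNth ![a, b, c] = ![a, c] := by
    funext i; fin_cases i <;> rfl
  have h2 : (2 : Fin 3).removeNth ![a, b, c] = ![a, b] := by
    funext i; fin_cases i <;> rfl
  rw [h0, h1, h2]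
  simp
  ring

theorem extDeriv_oneForm_apply {θ : E → E [⋀^Fin 1]→L[ℝ] ℝ} {y : E}
    (hθ : DifferentiableAt ℝ θ y) (a b : E) :
    extDeriv θ y ![a, b] =
      fderiv ℝ (fun z => θ z ![b]) y a - fderiv ℝ (fun z => θ z ![a]) y b := by
  rw [extDeriv_apply hθ, Fin.sum_univ_two]
  have h0 : (0 : Fin 2).removeNth ![a, b] = ![b] := by
    funext i; fin_cases i; rfl
  have h1 : (1 : Fin 2).removeNth ![a, b] = ![a] := by
    funext i; fin_cases i; rfl
  rw [h0, h1]
  simp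
  ring

/-- If `dη` and `d ι_X η` vanish at `y`, then so does the Lie derivative
`L_X η = ι_X dη + d ι_X η`, here evaluated on constant vectors `a`, `b`, `c`. -/
theorem lieDeriv_threeForm_eq_zero {η : E → E [⋀^Fin 3]→L[ℝ] ℝ} {X : E → E} {y : E}
    (hη : DifferentiableAt ℝ η y) (hX : DifferentiableAt ℝ X y) (hd : extDeriv η y = 0)
    (hdX : extDeriv (fun z => (η z).curryLeft (X z)) y = 0) (a b c : E) :
    fderiv ℝ η y (X y) ![a, b, c] + η y ![fderiv ℝ X y a, b, c] + η y ![a, fderiv ℝ X y b, c] +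
      η y ![a, b, fderiv ℝ X y c] = 0 := by
  have h1 := extDeriv_threeForm_apply η y (X y) a b c
  have hθ := differentiableAt_curryLeft_apply hη hX
  have h2 := extDeriv_twoForm_apply hθ a b c
  have h3 (u v w : E) : fderiv ℝ (fun z => (η z).curryLeft (X z) ![u, v]) y w =
      fderiv ℝ η y w ![X y, u, v] + η y ![fderiv ℝ X y w, u, v] := by
    have := fderiv_threeForm_apply hη hX (differentiableAt_const (c := u))
      (differentiableAt_const (c := v)) w
    have e1 : η y ![X y, 0, v] = 0 := (η y).map_coord_zero 1 rfl
    have e2 : η y ![X y, u, 0] = 0 := (η y).map_coord_zero 2 rfl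
    simpa [e1, e2] using this
  rw [hd] at h1
  rw [hdX, h3, h3, h3] at h2
  have s1 := threeForm_swap_fst (η y) a (fderiv ℝ X y b) c
  have s2 := threeForm_swap_snd (η y) a (fderiv ℝ X y c) b
  have s3 := threeForm_swap_fst (η y) a (fderiv ℝ X y c) b
  simp at h1 h2
  linarith

/-- For commuting `X`, `Y` preserving a closed form `η`, the form `ι_Y ι_X η` is closed: expand
`dη(a, X, Y, b) = 0` and replace the derivatives of `η` along `X` and `Y` using `L_X η = 0` and
`L_Y η = 0`. -/
theorem extDeriv_curryLeft_curryLeft_eq_zero {η : E → E [⋀^Fin 3]→L[ℝ] ℝ} {X Y : E → E} {y : E}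
    (hη : DifferentiableAt ℝ η y) (hX : DifferentiableAt ℝ X y) (hY : DifferentiableAt ℝ Y y)
    (hd : extDeriv η y = 0) (hdX : extDeriv (fun z => (η z).curryLeft (X z)) y = 0)
    (hdY : extDeriv (fun z => (η z).curryLeft (Y z)) y = 0) (hXY : lieBracket ℝ X Y y = 0) :
    extDeriv (fun z => ((η z).curryLeft (X z)).curryLeft (Y z)) y = 0 := by
  ext v
  have hv : v = ![v 0, v 1] := by funext i; fin_cases i <;> rfl
  rw [hv]
  generalize v 0 = a, v 1 = b
  have hθ := differentiableAt_curryLeft_apply (differentiableAt_curryLeft_apply hη hX) hY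
  rw [extDeriv_oneForm_apply hθ]
  have h3 (u w : E) : fderiv ℝ (fun z => ((η z).curryLeft (X z)).curryLeft (Y z) ![u]) y w =
      fderiv ℝ η y w ![X y, Y y, u] + η y ![fderiv ℝ X y w, Y y, u] +
        η y ![X y, fderiv ℝ Y y w, u] := by
    have := fderiv_threeForm_apply hη hX hY (differentiableAt_const (c := u)) w
    have e2 : η y ![X y, Y y, 0] = 0 := (η y).map_coord_zero 2 rfl
    simpa [e2] using this
  rw [h3, h3]
  have hXY' : fderiv ℝ Y y (X y) = fderiv ℝ X y (Y y) := by
    simpa [lieBracket, sub_eq_zero] using hXY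
  have hX1 := lieDeriv_threeForm_eq_zero hη hX hd hdX a (Y y) b
  have hY1 := lieDeriv_threeForm_eq_zero hη hY hd hdY a (X y) b
  have hd1 := extDeriv_threeForm_apply η y a (X y) (Y y) b
  rw [hd] at hd1
  rw [hXY'] at hY1
  have s1 := threeForm_swap_fst (η y) (fderiv ℝ Y y a) (X y) b
  have s2 := threeForm_swap_fst (η y) a (X y) (fderiv ℝ Y y b)
  have s3 := threeForm_swap_snd (η y) (X y) (fderiv ℝ Y y b) a
  have s4 := threeForm_swap_fst (η y) a (Y y) (fderiv ℝ X y b)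
  have s5 := threeForm_swap_snd (η y) (Y y) (fderiv ℝ X y b) a
  have s6 := threeForm_swap_fst (η y) (Y y) (fderiv ℝ X y b) a
  have s7 := threeForm_swap_fst (fderiv ℝ η y b) a (X y) (Y y)
  have s8 := threeForm_swap_snd (fderiv ℝ η y b) (X y) (Y y) a
  simp at hd1 ⊢
  linarith

/-- For pairwise commuting `X`, `Y`, `Z` preserving a closed form `η`, the function `η(X, Y, Z)` has
zero derivative: expand `dη(a, X, Y, Z) = 0` and replace the derivatives of `η` along the three
fields using `L_X η = L_Y η = L_Z η = 0`. -/
theorem fderiv_threeForm_eq_zero {η : E → E [⋀^Fin 3]→L[ℝ] ℝ} {X Y Z : E → E} {y : E}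
    (hη : DifferentiableAt ℝ η y) (hX : DifferentiableAt ℝ X y) (hY : DifferentiableAt ℝ Y y)
    (hZ : DifferentiableAt ℝ Z y)
    (hd : extDeriv η y = 0) (hdX : extDeriv (fun z => (η z).curryLeft (X z)) y = 0)
    (hdY : extDeriv (fun z => (η z).curryLeft (Y z)) y = 0)
    (hdZ : extDeriv (fun z => (η z).curryLeft (Z z)) y = 0)
    (hXY : lieBracket ℝ X Y y = 0) (hXZ : lieBracket ℝ X Z y = 0)
    (hYZ : lieBracket ℝ Y Z y = 0) :
    fderiv ℝ (fun z => η z ![X z, Y z, Z z]) y = 0 := by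
  ext a
  rw [fderiv_threeForm_apply hη hX hY hZ]
  have hXY' : fderiv ℝ Y y (X y) = fderiv ℝ X y (Y y) := by
    simpa [lieBracket, sub_eq_zero] using hXY
  have hXZ' : fderiv ℝ Z y (X y) = fderiv ℝ X y (Z y) := by
    simpa [lieBracket, sub_eq_zero] using hXZ
  have hYZ' : fderiv ℝ Z y (Y y) = fderiv ℝ Y y (Z y) := by
    simpa [lieBracket, sub_eq_zero] using hYZ
  have hX1 := lieDeriv_threeForm_eq_zero hη hX hd hdX a (Y y) (Z y)
  have hY1 := lieDeriv_threeForm_eq_zero hη hY hd hdY a (X y) (Z y)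
  have hZ1 := lieDeriv_threeForm_eq_zero hη hZ hd hdZ a (X y) (Y y)
  have hd1 := extDeriv_threeForm_apply η y a (X y) (Y y) (Z y)
  rw [hd] at hd1
  rw [hXY'] at hY1
  rw [hXZ', hYZ'] at hZ1
  have s1 := threeForm_swap_fst (η y) (fderiv ℝ Y y a) (X y) (Z y)
  have s2 := threeForm_swap_snd (η y) (fderiv ℝ Z y a) (X y) (Y y)
  have s3 := threeForm_swap_fst (η y) (X y) (fderiv ℝ Z y a) (Y y)
  have s4 := threeForm_swap_snd (η y) (X y) (Y y) (fderiv ℝ Z y a)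
  have t1 := threeForm_swap_snd (η y) a (fderiv ℝ X y (Y y)) (Z y)
  have t2 := threeForm_swap_snd (η y) a (fderiv ℝ X y (Z y)) (Y y)
  have t3 := threeForm_swap_snd (η y) a (fderiv ℝ Y y (Z y)) (X y)
  simp at hd1 ⊢
  linarith

end NormedSpace

/-! ### Fields and forms in charts -/

theorem minSmoothness_two_le_infty : minSmoothness ℝ 2 ≤ (∞ : ℕ∞ω) := by
  rw [minSmoothness_of_isRCLikeNormedField]
  exact WithTop.coe_le_coe.2 (le_top (a := (2 : ℕ∞)))

section Charts

variable {n : ℕ} {M : Type*} [TopologicalSpace M] [ChartedSpace (Model n) M]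

theorem differentiableAt_chartRep_of_mem {k : ℕ} (α : Form n M k) {x₀ : M} {y : Model n}
    (hy : y ∈ (extChartAt (𝓡 n) x₀).target) : DifferentiableAt ℝ (chartRep α.1 x₀) y :=
  ((α.2 x₀).contDiffAt ((isOpen_extChartAt_target x₀).mem_nhds hy)).differentiableAt (by simp)

variable [IsManifold (𝓡 n) ∞ M]

/-- The expression of a vector field in the chart around `x₀`: its pullback along the inverse
chart. It is meaningful on the target of the chart. -/
noncomputable def localField (X : VField n M) (x₀ : M) (y : Model n) : Model n :=
  (chartSymmDeriv x₀ y).inverse (X ((extChartAt (𝓡 n) x₀).symm y))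

theorem isInvertible_chartSymmDeriv {x₀ : M} {y : Model n}
    (hy : y ∈ (extChartAt (𝓡 n) x₀).target) : (chartSymmDeriv x₀ y).IsInvertible := by
  have : IsManifold (𝓡 n) 1 M := IsManifold.of_le (n := ∞) (by simp)
  have h := isInvertible_mfderivWithin_extChartAt_symm (I := 𝓡 n) hy
  rwa [ModelWithCorners.range_eq_univ, mfderivWithin_univ] at h

theorem chartSymmDeriv_localField (X : VField n M) {x₀ : M} {y : Model n}
    (hy : y ∈ (extChartAt (𝓡 n) x₀).target) :
    chartSymmDeriv x₀ y (localField X x₀ y) = X ((extChartAt (𝓡 n) x₀).symm y) := by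
  obtain ⟨e, he⟩ := isInvertible_chartSymmDeriv hy
  rw [localField, ← he, ContinuousLinearMap.inverse_equiv]
  exact e.apply_symm_apply _

theorem contDiffOn_localField (X : VField n M) (x₀ : M) :
    ContDiffOn ℝ ∞ (localField X x₀) (extChartAt (𝓡 n) x₀).target := by
  refine contMDiffOn_vectorSpace_iff_contDiffOn.1 ?_
  intro y hy
  have h := ContMDiffWithinAt.mpullbackWithin_vectorField (I := 𝓘(ℝ, Model n)) (I' := 𝓡 n)
    (f := (extChartAt (𝓡 n) x₀).symm) (V := X) (m := ∞) (n := ∞)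
    (s := (extChartAt (𝓡 n) x₀).target) (t := univ) (x₀ := y)
    X.contMDiff.contMDiffAt.contMDiffWithinAt (contMDiffOn_extChartAt_symm x₀ y hy)
    (by
      rw [mfderivWithin_of_isOpen (isOpen_extChartAt_target x₀) hy]
      exact isInvertible_chartSymmDeriv hy)
    hy (isOpen_extChartAt_target x₀).uniqueMDiffOn (by simp) (mapsTo_univ _ _)
  have heq : ∀ z ∈ (extChartAt (𝓡 n) x₀).target, (⟨z, localField X x₀ z⟩ : TangentBundle _ _) =
      ⟨z, mpullbackWithin 𝓘(ℝ, Model n) (𝓡 n) (extChartAt (𝓡 n) x₀).symm X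
        (extChartAt (𝓡 n) x₀).target z⟩ := fun z hz => by
    simp only [localField, mpullbackWithin_apply, chartSymmDeriv,
      mfderivWithin_of_isOpen (isOpen_extChartAt_target x₀) hz]
    rfl
  exact h.congr heq (heq y hy)

theorem lieBracket_localField (X Y : VField n M) (x : M)
    (h : mlieBracket (𝓡 n) X Y x = 0) :
    lieBracket ℝ (localField X x) (localField Y x) (extChartAt (𝓡 n) x x) = 0 := by
  have : IsManifold (𝓡 n) 1 M := IsManifold.of_le (n := ∞) (by simp)
  have hi := isInvertible_mfderiv_extChartAt (I := 𝓡 n) (mem_extChartAt_source (I := 𝓡 n) x)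
  rw [← mlieBracketWithin_univ, mlieBracketWithin_apply] at h
  simp only [ModelWithCorners.range_eq_univ, mpullbackWithin_univ, preimage_univ, inter_univ] at h
  obtain ⟨e, he⟩ := hi
  rw [← he, ContinuousLinearMap.inverse_equiv] at h
  rw [← lieBracketWithin_univ]
  exact e.symm.map_eq_zero_iff.1 h

theorem chartRep_contract {k : ℕ} (X : VField n M) (α : RawForm n M (k + 1)) {x₀ : M}
    {y : Model n} (hy : y ∈ (extChartAt (𝓡 n) x₀).target) :
    chartRep (contract X α) x₀ y = (chartRep α x₀ y).curryLeft (localField X x₀ y) := by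
  ext w
  change α _ (Matrix.vecCons _ _) = α _ (fun i => chartSymmDeriv x₀ y (Matrix.vecCons _ _ i))
  congr 1
  funext i
  refine Fin.cases ?_ (fun j => ?_) i
  · exact (chartSymmDeriv_localField X hy).symm
  · rfl

theorem IsSmoothForm.contract {k : ℕ} (X : VField n M) {α : RawForm n M (k + 1)}
    (hα : IsSmoothForm α) : IsSmoothForm (contract X α) := by
  intro x₀
  have h : ContDiffOn ℝ ∞ (fun y => (chartRep α x₀ y).curryLeft (localField X x₀ y))
      (extChartAt (𝓡 n) x₀).target := fun y hy =>
    contDiffWithinAt_curryLeft_apply (hα x₀ y hy) (contDiffOn_localField X x₀ y hy)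
  exact h.congr fun y hy => chartRep_contract X α hy

/-- A form is recovered from its expression in a chart by pulling back along the chart. -/
theorem chartRep_compContinuousLinearMap_mfderiv {k : ℕ} (α : RawForm n M k) {x₁ x : M}
    (hx : x ∈ (extChartAt (𝓡 n) x₁).source) :
    (chartRep α x₁ (extChartAt (𝓡 n) x₁ x)).compContinuousLinearMap
      (mfderiv (𝓡 n) 𝓘(ℝ, Model n) (extChartAt (𝓡 n) x₁) x) = α x := by
  have : IsManifold (𝓡 n) 1 M := IsManifold.of_le (n := ∞) (by simp)
  have hid := mfderivWithin_extChartAt_symm_comp_mfderiv_extChartAt' (I := 𝓡 n) hx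
  rw [ModelWithCorners.range_eq_univ, mfderivWithin_univ] at hid
  -- `φ⁻¹ (φ x) = x` is only propositional, so both tangent spaces are read as `Model n`.
  have hcongr : ∀ z, z = x → ∀ u w : Fin k → Model n, u = w → α z u = α x w := by
    rintro z rfl u w rfl
    rfl
  ext w
  refine hcongr _ ((extChartAt (𝓡 n) x₁).left_inv hx) _ w (funext fun i => ?_)
  exact DFunLike.congr_fun hid (w i)

theorem fderiv_chart_change {x₀ x₁ : M} {y : Model n}
    (hy : y ∈ (extChartAt (𝓡 n) x₀).target)
    (hy' : (extChartAt (𝓡 n) x₀).symm y ∈ (extChartAt (𝓡 n) x₁).source) :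
    fderiv ℝ (extChartAt (𝓡 n) x₁ ∘ (extChartAt (𝓡 n) x₀).symm) y =
      (mfderiv (𝓡 n) 𝓘(ℝ, Model n) (extChartAt (𝓡 n) x₁)
        ((extChartAt (𝓡 n) x₀).symm y)).comp (chartSymmDeriv x₀ y) := by
  have : IsManifold (𝓡 n) 1 M := IsManifold.of_le (n := ∞) (by simp)
  rw [← mfderiv_eq_fderiv]
  refine mfderiv_comp y (mdifferentiableAt_extChartAt (by simpa using hy')) ?_
  exact ((contMDiffOn_extChartAt_symm (n := 1) x₀).contMDiffAt
    ((isOpen_extChartAt_target x₀).mem_nhds hy)).mdifferentiableAt one_ne_zero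

theorem chartRep_change {k : ℕ} (α : RawForm n M k) {x₀ x₁ : M} {y : Model n}
    (hy : y ∈ (extChartAt (𝓡 n) x₀).target)
    (hy' : (extChartAt (𝓡 n) x₀).symm y ∈ (extChartAt (𝓡 n) x₁).source) :
    chartRep α x₀ y =
      (chartRep α x₁ (extChartAt (𝓡 n) x₁ ((extChartAt (𝓡 n) x₀).symm y))).compContinuousLinearMap
        (fderiv ℝ (extChartAt (𝓡 n) x₁ ∘ (extChartAt (𝓡 n) x₀).symm) y) := by
  rw [fderiv_chart_change hy hy', chartRep,
    ← chartRep_compContinuousLinearMap_mfderiv α hy']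
  rfl

theorem contMDiffAt_extChartAt_symm {x₀ : M} {y : Model n}
    (hy : y ∈ (extChartAt (𝓡 n) x₀).target) :
    ContMDiffAt 𝓘(ℝ, Model n) (𝓡 n) ∞ (extChartAt (𝓡 n) x₀).symm y :=
  (contMDiffOn_extChartAt_symm x₀).contMDiffAt ((isOpen_extChartAt_target x₀).mem_nhds hy)

theorem contDiffAt_chart_change {x₀ : M} {y : Model n} (hy : y ∈ (extChartAt (𝓡 n) x₀).target) :
    ContDiffAt ℝ ∞ (extChartAt (𝓡 n) ((extChartAt (𝓡 n) x₀).symm y) ∘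
      (extChartAt (𝓡 n) x₀).symm) y := by
  rw [← contMDiffAt_iff_contDiffAt]
  exact ContMDiffAt.comp y contMDiffAt_extChartAt (contMDiffAt_extChartAt_symm hy)

theorem eventually_symm_mem_source {x₀ : M} {y : Model n}
    (hy : y ∈ (extChartAt (𝓡 n) x₀).target) :
    ∀ᶠ z in 𝓝 y, z ∈ (extChartAt (𝓡 n) x₀).target ∧ (extChartAt (𝓡 n) x₀).symm z ∈
      (extChartAt (𝓡 n) ((extChartAt (𝓡 n) x₀).symm y)).source :=
  eventually_and.2 ⟨(isOpen_extChartAt_target x₀).mem_nhds hy,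
    (contMDiffAt_extChartAt_symm hy).continuousAt.preimage_mem_nhds
      (extChartAt_source_mem_nhds _)⟩

/-- The exterior derivative does not depend on the chart: although `extDerRaw α` is computed at each
point in the chart around that point, in any chart it is the exterior derivative of the expression
of `α` in that chart. -/
theorem chartRep_extDerRaw {k : ℕ} {α : RawForm n M k} (hα : IsSmoothForm α) {x₀ : M}
    {y : Model n} (hy : y ∈ (extChartAt (𝓡 n) x₀).target) :
    chartRep (extDerRaw α) x₀ y = extDeriv (chartRep α x₀) y := by
  set φ := extChartAt (𝓡 n) x₀ with hφ
  set x := φ.symm y with hx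
  set ψ := extChartAt (𝓡 n) x with hψ
  have hxs : x ∈ ψ.source := mem_extChartAt_source x
  have hτ : ContDiffAt ℝ ∞ (ψ ∘ φ.symm) y := contDiffAt_chart_change hy
  have hev : chartRep α x₀ =ᶠ[𝓝 y] fun z =>
      (chartRep α x ((ψ ∘ φ.symm) z)).compContinuousLinearMap (fderiv ℝ (ψ ∘ φ.symm) z) := by
    filter_upwards [eventually_symm_mem_source hy] with z ⟨hz, hz'⟩
    exact chartRep_change α hz hz'
  have hαx : DifferentiableAt ℝ (chartRep α x) ((ψ ∘ φ.symm) y) :=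
    ((hα x).contDiffAt (extChartAt_target_mem_nhds x)).differentiableAt (by simp)
  rw [hev.extDeriv_eq, extDeriv_pullback hαx hτ minSmoothness_two_le_infty,
    fderiv_chart_change hy hxs]
  rfl

end Charts

/-! ### Contractions with commuting Hamiltonian vector fields -/

section Hamiltonian

variable {n : ℕ} {M : Type*} [TopologicalSpace M] [ChartedSpace (Model n) M]
  [IsManifold (𝓡 n) ∞ M]

theorem extDeriv_chartRep_eq_zero {k : ℕ} {α : Form n M k} (hα : extDer k α = 0) {x₀ : M}
    {y : Model n} (hy : y ∈ (extChartAt (𝓡 n) x₀).target) :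
    extDeriv (chartRep α.1 x₀) y = 0 := by
  rw [← chartRep_extDerRaw α.2 hy]
  change chartRep (extDer k α) x₀ y = 0
  rw [hα, chartRep_zero]
  rfl

/-- The contraction of `ω₀` with a Hamiltonian vector field is closed, being `-dα`; stated in
a chart. -/
theorem IsHamiltonianPair.extDeriv_curryLeft_eq_zero {ω₀ : Form n M 3} {α : Form n M 1}
    {X : VField n M} (h : IsHamiltonianPair ω₀ α X) {x₀ : M}
    {y : Model n} (hy : y ∈ (extChartAt (𝓡 n) x₀).target) :
    extDeriv (fun z => (chartRep ω₀.1 x₀ z).curryLeft (localField X x₀ z)) y = 0 := by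
  have hev : (fun z => (chartRep ω₀.1 x₀ z).curryLeft (localField X x₀ z)) =ᶠ[𝓝 y]
      (-1 : ℝ) • extDeriv (chartRep α.1 x₀) := by
    filter_upwards [(isOpen_extChartAt_target x₀).mem_nhds hy] with z hz
    have h1 : contract X ω₀.1 = (-1 : ℝ) • extDerRaw α.1 := by
      rw [neg_one_smul]
      exact (neg_eq_iff_eq_neg.2 h).symm
    rw [← chartRep_contract X ω₀.1 hz, h1, chartRep_smul, Pi.smul_apply, Pi.smul_apply,
      chartRep_extDerRaw α.2 hz]
  rw [hev.extDeriv_eq, extDeriv_smul, extDeriv_extDeriv_apply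
    ((α.2 x₀).contDiffAt ((isOpen_extChartAt_target x₀).mem_nhds hy))
    minSmoothness_two_le_infty, smul_zero]

theorem differentiableAt_localField (X : VField n M) {x₀ : M} {y : Model n}
    (hy : y ∈ (extChartAt (𝓡 n) x₀).target) : DifferentiableAt ℝ (localField X x₀) y :=
  ((contDiffOn_localField X x₀).contDiffAt
    ((isOpen_extChartAt_target x₀).mem_nhds hy)).differentiableAt (by simp)

theorem extDer_contract_contract_eq_zero {ω₀ : Form n M 3} (hω : extDer 3 ω₀ = 0)
    {α β : Form n M 1} {X Y : VField n M} (hX : IsHamiltonianPair ω₀ α X)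
    (hY : IsHamiltonianPair ω₀ β Y) (hXY : ∀ x, mlieBracket (𝓡 n) X Y x = 0) :
    extDer 1 ⟨contract Y (contract X ω₀.1), (ω₀.2.contract X).contract Y⟩ = 0 := by
  funext x
  have hy := mem_extChartAt_target (I := 𝓡 n) x
  have hev : chartRep (contract Y (contract X ω₀.1)) x =ᶠ[𝓝 (extChartAt (𝓡 n) x x)]
      fun z => ((chartRep ω₀.1 x z).curryLeft (localField X x z)).curryLeft
        (localField Y x z) := by
    filter_upwards [extChartAt_target_mem_nhds (I := 𝓡 n) x] with z hz
    rw [chartRep_contract Y _ hz, chartRep_contract X _ hz]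
  change (extDeriv (chartRep (contract Y (contract X ω₀.1)) x) _).compContinuousLinearMap _ = 0
  rw [hev.extDeriv_eq, extDeriv_curryLeft_curryLeft_eq_zero (differentiableAt_chartRep_of_mem ω₀ hy)
    (differentiableAt_localField X hy) (differentiableAt_localField Y hy)
    (extDeriv_chartRep_eq_zero hω hy) (hX.extDeriv_curryLeft_eq_zero hy)
    (hY.extDeriv_curryLeft_eq_zero hy) (lieBracket_localField X Y x (hXY x))]
  rfl

theorem threeForm_apply_eq_chartRep (η : RawForm n M 3) (X Y Z : VField n M) {x₀ : M} {y : Model n}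
    (hy : y ∈ (extChartAt (𝓡 n) x₀).target) :
    η ((extChartAt (𝓡 n) x₀).symm y) ![X ((extChartAt (𝓡 n) x₀).symm y),
      Y ((extChartAt (𝓡 n) x₀).symm y), Z ((extChartAt (𝓡 n) x₀).symm y)] =
    chartRep η x₀ y ![localField X x₀ y, localField Y x₀ y, localField Z x₀ y] := by
  rw [← chartSymmDeriv_localField X hy, ← chartSymmDeriv_localField Y hy,
    ← chartSymmDeriv_localField Z hy]
  change η _ _ = η _ _
  congr 1
  funext i
  fin_cases i <;> rfl

/-- The function `ω₀(X, Y, Z)` has zero derivative at every point `y` of every chart, for pairwise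
commuting Hamiltonian vector fields. The bracket of vector fields on `M` is defined at a point
through the chart around that point, so the derivative is computed in the chart around `φ⁻¹ y` and
transported by the change of charts. -/
theorem fderiv_threeForm_chart_eq_zero {ω₀ : Form n M 3} (hω : extDer 3 ω₀ = 0)
    {α β γ : Form n M 1} {X Y Z : VField n M} (hX : IsHamiltonianPair ω₀ α X)
    (hY : IsHamiltonianPair ω₀ β Y) (hZ : IsHamiltonianPair ω₀ γ Z)
    (hXY : ∀ x, mlieBracket (𝓡 n) X Y x = 0) (hXZ : ∀ x, mlieBracket (𝓡 n) X Z x = 0)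
    (hYZ : ∀ x, mlieBracket (𝓡 n) Y Z x = 0) {x₀ : M} {y : Model n}
    (hy : y ∈ (extChartAt (𝓡 n) x₀).target) :
    fderiv ℝ (fun y => chartRep ω₀.1 x₀ y
      ![localField X x₀ y, localField Y x₀ y, localField Z x₀ y]) y = 0 := by
  set φ := extChartAt (𝓡 n) x₀ with hφ
  set x := φ.symm y with hx
  set ψ := extChartAt (𝓡 n) x with hψ
  have hτ : ContDiffAt ℝ ∞ (ψ ∘ φ.symm) y := contDiffAt_chart_change hy
  let g : Model n → ℝ := fun z =>
    chartRep ω₀.1 x z ![localField X x z, localField Y x z, localField Z x z]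
  have hev : (fun y => chartRep ω₀.1 x₀ y
      ![localField X x₀ y, localField Y x₀ y, localField Z x₀ y]) =ᶠ[𝓝 y] g ∘ (ψ ∘ φ.symm) := by
    filter_upwards [eventually_symm_mem_source hy] with z ⟨hz, hz'⟩
    have h := threeForm_apply_eq_chartRep ω₀.1 X Y Z (ψ.map_source hz')
    rw [← hψ, ψ.left_inv hz'] at h
    rw [← threeForm_apply_eq_chartRep ω₀.1 X Y Z hz]
    exact h
  have hc := mem_extChartAt_target (I := 𝓡 n) x
  have hgd : DifferentiableAt ℝ g (ψ x) := differentiableAt_threeForm_apply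
    (differentiableAt_chartRep_of_mem ω₀ hc) (differentiableAt_localField X hc)
    (differentiableAt_localField Y hc) (differentiableAt_localField Z hc)
  have hg0 : fderiv ℝ g (ψ x) = 0 := fderiv_threeForm_eq_zero
    (differentiableAt_chartRep_of_mem ω₀ hc) (differentiableAt_localField X hc)
    (differentiableAt_localField Y hc) (differentiableAt_localField Z hc)
    (extDeriv_chartRep_eq_zero hω hc) (hX.extDeriv_curryLeft_eq_zero hc)
    (hY.extDeriv_curryLeft_eq_zero hc) (hZ.extDeriv_curryLeft_eq_zero hc)
    (lieBracket_localField X Y x (hXY x)) (lieBracket_localField X Z x (hXZ x))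
    (lieBracket_localField Y Z x (hYZ x))
  rw [hev.fderiv_eq, fderiv_comp y hgd (hτ.differentiableAt (by simp))]
  change (fderiv ℝ g (ψ x)).comp _ = 0
  rw [hg0, ContinuousLinearMap.zero_comp]

theorem isLocallyConstant_threeForm_apply {ω₀ : Form n M 3} (hω : extDer 3 ω₀ = 0)
    {α β γ : Form n M 1} {X Y Z : VField n M} (hX : IsHamiltonianPair ω₀ α X)
    (hY : IsHamiltonianPair ω₀ β Y) (hZ : IsHamiltonianPair ω₀ γ Z)
    (hXY : ∀ x, mlieBracket (𝓡 n) X Y x = 0) (hXZ : ∀ x, mlieBracket (𝓡 n) X Z x = 0)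
    (hYZ : ∀ x, mlieBracket (𝓡 n) Y Z x = 0) :
    IsLocallyConstant fun x => ω₀.1 x ![X x, Y x, Z x] := by
  rw [IsLocallyConstant.iff_eventually_eq]
  intro x
  set φ := extChartAt (𝓡 n) x with hφ
  let g : Model n → ℝ := fun y =>
    chartRep ω₀.1 x y ![localField X x y, localField Y x y, localField Z x y]
  obtain ⟨r, hr, hball⟩ := Metric.isOpen_iff.1 (isOpen_extChartAt_target (I := 𝓡 n) x) (φ x)
    (mem_extChartAt_target x)
  have hg : ∀ y ∈ φ.target, DifferentiableAt ℝ g y := fun y hy =>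
    differentiableAt_threeForm_apply
      (differentiableAt_chartRep_of_mem ω₀ hy) (differentiableAt_localField X hy)
      (differentiableAt_localField Y hy) (differentiableAt_localField Z hy)
  have hg' : ∀ y ∈ φ.target, fderiv ℝ g y = 0 := fun y hy =>
    fderiv_threeForm_chart_eq_zero hω hX hY hZ hXY hXZ hYZ hy
  have hconst : ∀ y ∈ Metric.ball (φ x) r, g y = g (φ x) := fun y hy =>
    Metric.isOpen_ball.is_const_of_fderiv_eq_zero (convex_ball _ _).isPreconnected
      (fun z hz => (hg z (hball hz)).differentiableWithinAt) (fun z hz => hg' z (hball hz)) hy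
      (Metric.mem_ball_self hr)
  have hval : ∀ z ∈ φ.source, ω₀.1 z ![X z, Y z, Z z] = g (φ z) := fun z hz => by
    have h := threeForm_apply_eq_chartRep ω₀.1 X Y Z (φ.map_source hz)
    rw [← hφ, φ.left_inv hz] at h
    exact h
  filter_upwards [extChartAt_source_mem_nhds (I := 𝓡 n) x,
    (continuousAt_extChartAt (I := 𝓡 n) x).preimage_mem_nhds (Metric.ball_mem_nhds _ hr)]
    with z hz hz'
  rw [hval z hz, hval x (mem_extChartAt_source x), hconst _ hz']

end Hamiltonian

/-! ### Linear lifts -/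

theorem exists_linearMap_lift {V W G : Type*} [AddCommGroup V] [Module ℝ V] [AddCommGroup W]
    [Module ℝ W] [AddCommGroup G] [Module ℝ G] (d : V →ₗ[ℝ] W) (g : G →ₗ[ℝ] W)
    (h : ∀ x, g x ∈ LinearMap.range d) : ∃ s : G →ₗ[ℝ] V, ∀ x, d (s x) = g x := by
  obtain ⟨s, hs⟩ := Module.projective_lifting_property d.rangeRestrict (g.codRestrict _ h)
    d.surjective_rangeRestrict
  exact ⟨s, fun x => congrArg Subtype.val (DFunLike.congr_fun hs x)⟩

theorem exists_alternatingMap_lift {V W G : Type*} [AddCommGroup V] [Module ℝ V]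
    [AddCommGroup W] [Module ℝ W] [AddCommGroup G] [Module ℝ G] {ι : Type*} (d : V →ₗ[ℝ] W)
    (g : G [⋀^ι]→ₗ[ℝ] W) (h : ∀ m, g m ∈ LinearMap.range d) :
    ∃ s : G [⋀^ι]→ₗ[ℝ] V, ∀ m, d (s m) = g m := by
  obtain ⟨s, hs⟩ := exists_linearMap_lift d (LinearMap.range d).subtype fun x => x.2
  exact ⟨s.compAlternatingMap (g.codRestrict _ h), fun m => hs _⟩

theorem exists_dual_comp_eq {V W : Type*} [AddCommGroup V] [Module ℝ V] [AddCommGroup W]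
    [Module ℝ W] (q : V →ₗ[ℝ] W) (ℓ : V →ₗ[ℝ] ℝ) (h : ∀ x, q x = 0 → ℓ x = 0) :
    ∃ φ : W →ₗ[ℝ] ℝ, ∀ x, φ (q x) = ℓ x := by
  have hℓ : ℓ ∈ (LinearMap.ker q).dualAnnihilator :=
    (Submodule.mem_dualAnnihilator _).2 fun x hx => h x hx
  rw [← LinearMap.range_dualMap_eq_dualAnnihilator_ker] at hℓ
  obtain ⟨φ, hφ⟩ := hℓ
  exact ⟨φ, fun x => DFunLike.congr_fun hφ x⟩

/-! ### Exact forms and Hamiltonian vector fields -/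

section Geometry

variable {n : ℕ} {M : Type*} [TopologicalSpace M] [ChartedSpace (Model n) M]

variable (n M) in
/-- The inclusion of the constant functions into `C^∞(M)`. -/
noncomputable def constFun : ℝ →ₗ[ℝ] SmoothFun n M where
  toFun r := ContMDiffMap.const r
  map_add' _ _ := rfl
  map_smul' _ _ := rfl

theorem extDerFun_constFun (r : ℝ) : extDerFun (constFun n M r) = 0 := by
  funext x
  change ContinuousAlternatingMap.ofSubsingleton ℝ _ ℝ 0 (mfderiv (𝓡 n) 𝓘(ℝ, ℝ) (fun _ => r) x) = 0
  rw [mfderiv_const]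
  ext
  rfl

theorem mem_range_extDerFun [hH1 : Subsingleton (DeRhamH1 n M)] {θ : Form n M 1}
    (hθ : extDer 1 θ = 0) : θ.1 ∈ LinearMap.range (extDerFun (n := n) (M := M)) := by
  have h : (⟨θ, hθ⟩ : ClosedOneForm n M) ∈
      (ExactOneForm n M).submoduleOf (ClosedOneForm n M) :=
    (Submodule.Quotient.mk_eq_zero _).1 (Subsingleton.elim _ _)
  exact h

variable [IsManifold (𝓡 n) ∞ M]

theorem IsTwoPlectic.hamiltonianField_unique {ω₀ : Form n M 3} (hω : IsTwoPlectic ω₀)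
    {α : Form n M 1} {X Y : VField n M} (hX : IsHamiltonianPair ω₀ α X)
    (hY : IsHamiltonianPair ω₀ α Y) : X = Y := by
  have h : contract X ω₀.1 = contract Y ω₀.1 := neg_injective (hX.symm.trans hY)
  ext1 x
  refine sub_eq_zero.1 (hω.nondegenerate x (X x - Y x) fun a b => ?_)
  have hx : contract (X - Y) ω₀.1 x ![a, b] = 0 := by
    have : contract (X - Y) ω₀.1 = 0 := by
      rw [sub_eq_add_neg, ← neg_one_smul ℝ Y, contract_add_left, contract_smul_left, h]
      simp
    rw [this]; rfl
  exact hx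

/-- The alternating map `(x, y) ↦ ι_{v_y} ι_{v_x} η`. -/
noncomputable def contractPair {𝔤 : Type*} [AddCommGroup 𝔤] [Module ℝ 𝔤] (v : 𝔤 →ₗ[ℝ] VField n M)
    (η : RawForm n M 3) : 𝔤 [⋀^Fin 2]→ₗ[ℝ] RawForm n M 1 where
  toFun m := contract (v (m 1)) (contract (v (m 0)) η)
  map_update_add' m i a b := by
    fin_cases i
    · simp [contract_add_left]
      rfl
    · simp [contract_add_left]
  map_update_smul' m i r a := by
    fin_cases i
    · simp [contract_smul_left]
      rfl
    · simp [contract_smul_left]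
  map_eq_zero_of_eq' m i j hij hne := by
    have h01 : m 0 = m 1 := by
      fin_cases i <;> fin_cases j <;> simp_all
    funext x
    ext w
    rw [contract_apply, contract_apply, h01]
    exact (η x).map_eq_zero_of_eq _ (i := 0) (j := 1) rfl (by decide)

end Geometry

/-! ### Moment maps for abelian Lie algebras -/

section MomentMap

variable {n : ℕ} {M : Type*} [TopologicalSpace M] [ChartedSpace (Model n) M]
  [IsManifold (𝓡 n) ∞ M]
  {𝔤 𝔥 : Type*} [LieRing 𝔤] [LieAlgebra ℝ 𝔤] [IsLieAbelian 𝔤]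
  [AddCommGroup 𝔥] [Module ℝ 𝔥] [LieRingModule 𝔤 𝔥]

theorem HamiltonianAction.mlieBracket_eq_zero {ω₀ : Form n M 3} (A : HamiltonianAction 𝔤 ω₀)
    (x y : 𝔤) (p : M) : mlieBracket (𝓡 n) (A.v x) (A.v y) p = 0 := by
  rw [← A.map_lie, trivial_lie_zero, map_zero]
  rfl

/-- The function `ω₀(v_x, v_y, v_z)` is constant on a connected `M`. -/
theorem HamiltonianAction.threeForm_apply_eq [PreconnectedSpace M] {ω₀ : Form n M 3}
    (hω : extDer 3 ω₀ = 0) (A : HamiltonianAction 𝔤 ω₀) (x y z : 𝔤) (p q : M) :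
    ω₀.1 q ![A.v x q, A.v y q, A.v z q] = omega3p A p ![x, y, z] := by
  obtain ⟨α, hα⟩ := A.hamiltonian x
  obtain ⟨β, hβ⟩ := A.hamiltonian y
  obtain ⟨γ, hγ⟩ := A.hamiltonian z
  have h := (isLocallyConstant_threeForm_apply hω hα hβ hγ (A.mlieBracket_eq_zero x y)
    (A.mlieBracket_eq_zero x z) (A.mlieBracket_eq_zero y z)).apply_eq_of_preconnectedSpace q p
  refine h.trans ?_
  change ω₀.1 p _ = ω₀.1 p _
  congr 1
  funext i
  fin_cases i <;> rfl

theorem hamField_eq {ω₀ : Form n M 3} (hω : IsTwoPlectic ω₀) {α : HamForm ω₀} {X : VField n M}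
    (h : IsHamiltonianPair ω₀ α X) : hamField α = X :=
  hω.hamiltonianField_unique α.2.choose_spec h

/-- For abelian `𝔤` the right side of the trinary equation vanishes, so it reads
`ω₀(v_x, v_y, v_z) = -f₁ (c(x, y, z))`. -/
theorem omega3p_eq_of_isMomentMap {ω₀ : Form n M 3} (hω : IsTwoPlectic ω₀)
    {L : MinimalLieTwo 𝔤 𝔥} {A : HamiltonianAction 𝔤 ω₀} {f : LInfMorphism L ω₀}
    (hf : IsMomentMap A f) (p : M) (x y z : 𝔤) :
    omega3p A p ![x, y, z] = -f.f₁' (L.c ![x, y, z]) p := by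
  have h := f.map_trinary x y z p
  have h0 (a : 𝔤) : f.f₂ ![a, 0] = 0 := f.f₂.map_coord_zero 1 rfl
  simp only [trivial_lie_zero, h0] at h
  have e : obsBracket₃ (f.f₁ x) (f.f₁ y) (f.f₁ z) p = -omega3p A p ![x, y, z] := by
    rw [obsBracket₃, hamField_eq hω (hf x), hamField_eq hω (hf y), hamField_eq hω (hf z)]
    change -ω₀.1 p _ = -ω₀.1 p _
    congr 2
    funext i
    fin_cases i <;> rfl
  rw [e] at h
  have z0 : (0 : SmoothFun n M) p = 0 := rfl
  rw [z0] at h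
  linarith

/-- On `U` the form `ω_{3p}` is `-f₁ ∘ c` evaluated at `p`, and `f₁` kills `[𝔤, 𝔥]`. -/
theorem omega3p_eq_zero_of_isMomentMap [LieModule ℝ 𝔤 𝔥] {ω₀ : Form n M 3} (hω : IsTwoPlectic ω₀)
    {L : MinimalLieTwo 𝔤 𝔥} {A : HamiltonianAction 𝔤 ω₀} {f : LInfMorphism L ω₀}
    (hf : IsMomentMap A f) (p : M) {u : ⋀[ℝ]^3 𝔤} (hu : u ∈ subspaceU L) :
    exteriorPower.alternatingMapLinearEquiv (omega3p A p) u = 0 := by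
  let ψ : 𝔥 →ₗ[ℝ] ℝ :=
    { toFun := fun h => f.f₁' h p
      map_add' := fun a b => by rw [map_add]; rfl
      map_smul' := fun r a => by rw [map_smul]; rfl }
  have hψ : exteriorPower.alternatingMapLinearEquiv (omega3p A p) =
      -(ψ ∘ₗ exteriorPower.alternatingMapLinearEquiv L.c) := by
    apply exteriorPower.linearMap_ext
    ext m
    have hm : m = ![m 0, m 1, m 2] := by funext i; fin_cases i <;> rfl
    rw [hm]
    simp only [LinearMap.compAlternatingMap_apply, LinearMap.neg_apply, LinearMap.comp_apply,
      exteriorPower.alternatingMapLinearEquiv_apply_ιMulti]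
    exact omega3p_eq_of_isMomentMap hω hf p (m 0) (m 1) (m 2)
  have hker : (⁅(⊤ : LieIdeal ℝ 𝔤), (⊤ : LieSubmodule ℝ 𝔤 𝔥)⁆ : LieSubmodule ℝ 𝔤 𝔥).toSubmodule ≤
      LinearMap.ker ψ := by
    rw [LieSubmodule.lieIdeal_oper_eq_linear_span, Submodule.span_le]
    rintro _ ⟨x, h, rfl⟩
    have hact := f.map_action x.1 h.1
    rw [map_neg, neg_eq_zero] at hact
    change f.f₁' ⁅x.1, h.1⁆ p = 0
    rw [hact]
    rfl
  have hu' := hker hu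
  rw [hψ, LinearMap.neg_apply, LinearMap.comp_apply, LinearMap.mem_ker.1 hu', neg_zero]

/-- If `ω_{3p}` vanishes on `U = ker (⋀³𝔤 → 𝔥 ⧸ [𝔤, 𝔥])`, it factors through `c` as a functional `φ`
on `𝔥 ⧸ [𝔤, 𝔥]`. The moment map consists of linearly chosen Hamiltonian 1-forms, the constants
`-φ(h)`, and linearly chosen primitives of `-ι_{v_y} ι_{v_x} ω₀`. -/
theorem exists_isMomentMap [PreconnectedSpace M] (hH1 : Subsingleton (DeRhamH1 n M))
    {ω₀ : Form n M 3} (hω : IsTwoPlectic ω₀) (L : MinimalLieTwo 𝔤 𝔥) (A : HamiltonianAction 𝔤 ω₀)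
    (p : M) (hU : ∀ u ∈ subspaceU L, exteriorPower.alternatingMapLinearEquiv (omega3p A p) u = 0) :
    ∃ f : LInfMorphism L ω₀, IsMomentMap A f := by
  let N := (⁅(⊤ : LieIdeal ℝ 𝔤), (⊤ : LieSubmodule ℝ 𝔤 𝔥)⁆ : LieSubmodule ℝ 𝔤 𝔥).toSubmodule
  obtain ⟨φ, hφ⟩ := exists_dual_comp_eq
    (N.mkQ ∘ₗ exteriorPower.alternatingMapLinearEquiv L.c)
    (exteriorPower.alternatingMapLinearEquiv (omega3p A p))
    fun u hu => hU u ((Submodule.Quotient.mk_eq_zero N).1 hu)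
  have hφc (x y z : 𝔤) : φ (N.mkQ (L.c ![x, y, z])) = omega3p A p ![x, y, z] := by
    simpa using hφ (exteriorPower.ιMulti ℝ 3 ![x, y, z])
  let ι : 𝔤 →ₗ[ℝ] RawForm n M 2 :=
    { toFun := fun x => -contract (A.v x) ω₀.1
      map_add' := fun x y => by rw [map_add, contract_add_left, neg_add]
      map_smul' := fun r x => by rw [map_smul, contract_smul_left, smul_neg]; rfl }
  -- `s` is a linear choice of Hamiltonian 1-forms.
  obtain ⟨s, hs⟩ := exists_linearMap_lift (extDer (n := n) (M := M) 1) ι A.hamiltonian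
  have hs' (x : 𝔤) : IsHamiltonianPair ω₀ (s x) (A.v x) := hs x
  -- `t` is a linear choice of primitives, which exist because `H¹(M) = 0`.
  obtain ⟨t, ht⟩ := exists_alternatingMap_lift (extDerFun (n := n) (M := M))
    (-contractPair A.v ω₀.1) fun m => neg_mem (mem_range_extDerFun
      (extDer_contract_contract_eq_zero hω.closed (hs' (m 0)) (hs' (m 1))
        (A.mlieBracket_eq_zero (m 0) (m 1))))
  let f₁ : 𝔤 →ₗ[ℝ] HamForm ω₀ := s.codRestrict _ fun x => ⟨A.v x, hs' x⟩
  have hfield (x : 𝔤) : hamField (f₁ x) = A.v x := hamField_eq hω (hs' x)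
  have ht0 (a : 𝔤) : t ![a, 0] = 0 := t.map_coord_zero 1 rfl
  refine ⟨⟨f₁, constFun n M ∘ₗ (-φ) ∘ₗ N.mkQ, t, fun h => extDerFun_constFun _, fun x y => ?_,
    fun x h => ?_, fun x y z q => ?_⟩, hs'⟩
  · rw [ht, obsBracket₂, hfield, hfield, trivial_lie_zero, map_zero]
    exact (zero_sub _).symm
  · have hN : N.mkQ (-⁅x, h⁆) = 0 := (Submodule.Quotient.mk_eq_zero _).2
      (neg_mem (LieSubmodule.lie_mem_lie (LieSubmodule.mem_top x) (LieSubmodule.mem_top h)))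
    rw [LinearMap.comp_apply, LinearMap.comp_apply, hN, map_zero, map_zero]
  · simp only [trivial_lie_zero, ht0]
    rw [obsBracket₃, hfield, hfield, hfield, A.threeForm_apply_eq hω.closed x y z p q, ← hφc]
    change -φ (N.mkQ (L.c ![x, y, z])) - -φ (N.mkQ (L.c ![x, y, z])) = 0 - 0 + 0
    ring

end MomentMap

end Lie2Moment

theorem mainTheorem10
    {n : ℕ} {M : Type*} [TopologicalSpace M] [T2Space M] [SecondCountableTopology M]
    [ConnectedSpace M] [ChartedSpace (Model n) M] [IsManifold (𝓡 n) ∞ M]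
    (hH1 : Subsingleton (DeRhamH1 n M))
    (ω₀ : Form n M 3) (hω : IsTwoPlectic ω₀)
    {𝔤 𝔥 : Type*} [LieRing 𝔤] [LieAlgebra ℝ 𝔤] [FiniteDimensional ℝ 𝔤] [IsLieAbelian 𝔤]
    [AddCommGroup 𝔥] [Module ℝ 𝔥] [FiniteDimensional ℝ 𝔥]
    [LieRingModule 𝔤 𝔥] [LieModule ℝ 𝔤 𝔥]
    (L : MinimalLieTwo 𝔤 𝔥) (A : HamiltonianAction 𝔤 ω₀) (p : M) :
    (∃ f : LInfMorphism L ω₀, IsMomentMap A f) ↔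
      ∀ u ∈ subspaceU L, exteriorPower.alternatingMapLinearEquiv (omega3p A p) u = 0 := by
  exact ⟨fun ⟨_, hf⟩ _ hu => omega3p_eq_zero_of_isMomentMap hω hf p hu,
    exists_isMomentMap hH1 hω L A p⟩
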